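/- Let $N,K\ge 1$, let $f_1,\dots,f_N:\mathbb R^K\to\mathbb R$ be continuously differentiable and $f=\frac1N\sum_i f_i$. Assume that $f(u)>\underline f$ for all $u\in\mathbb R^K$, and that for every compact $S\subset\mathbb R^K$ each $\nabla f_i$ is Lipschitz on $S$ with a constant $L_i(S)\ge 1$, where $L_i(S_1)\le L_i(S_2)$ if $S_1\subseteq S_2$. Let $W\in\mathbb R^{N\times N}$ be a mixing matrix of an undirected graph on $\{1,\dots,N\}$: $W$ is symmetric, $\mathrm{Null}(I-W)=\mathrm{span}\{\mathbf 1\}$, $-I\preceq W\preceq I$, $W_{ii}\ge0$, and for $i\ne j$, $W_{ij}>0$ if $\{i,j\}$ is an edge and $W_{ij}=0$ otherwise. Let $\eta$ be the largest absolute value of an eigenvalue of $W$ other than $1$ ($\eta=0$ if $N=1$), and assume $\eta<1$ and $\|W-\frac1N\mathbf 1\mathbf 1^T\|<1$ (spectral norm). Let $\gamma,\xi>0$ with $(1+\gamma)\eta^2<1$, $(1+\xi)\eta^2<1$, and let $0<\varepsilon<2(1-(1+\gamma)\eta^2)$. MAGENTA: given $x(0)=(x_1(0),\dots,x_N(0))\in(\mathbb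 R^K)^N$ and radii $v^0<v^1<v^2<\cdots$, let $z=\bar x(0)=\frac1N\sum_i x_i(0)$ (a bar always denotes the average over the agents), let $X(t)$ be the closed ball of radius $v^t$ centred at $z$, and assume $x_i(0)\in X(0)$ for all $i$. Put $y_i(0)=\nabla f_i(x_i(0))$, $\hat L(t)=\max_i L_i(X(t))$ and $$\alpha(t)=\min\Big\{\tfrac{1}{8N}\Big(\tfrac{\hat L(t)}{2N}+\tfrac1\gamma+\tfrac54\Big)^{-1},\ \tfrac{N(1-(1+\gamma)\eta^2)(1-(1+\xi)\eta^2)}{64(1+1/\xi)\hat L(t)^2},\ 1\Big\}.$$ Stage $t=0,1,2,\dots$ starts from $x^0_i(t)=x_i(t)$, $y_i^0(t)=y_i(t)$, performs for $r=0,\dots,R(t)-1$ and all $i$ the updates (stage index suppressed) $$\tilde x_i^{r+1}=\arg\min_{u\in X(t)}\ \langle y_i^r,u-x_i^r\rangle+\tfrac1{2\alpha(t)}\|u-x_i^r\|^2,$$ $$x_i^{r+1}=\sum_j W_{ij}\big(x_j^r+\tfrac12(\tilde x_j^{r+1}-x_j^r)\big),\qquad y_i^{r+1}=\sum_j W_{ij}y_j^r+\nabla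 f_i(x_i^{r+1})-\nabla f_i(x_i^r),$$ and outputs $x(t+1)=x^{R(t)}(t)$, $y(t+1)=y^{R(t)}(t)$. Let $R(t)=\lceil 1/(\varepsilon\alpha(t))\rceil$ for $t\ge1$; the length $R(0)\ge0$ of the preliminary stage $0$ is arbitrary ($R(0)=0$ means that the method starts with stage $1$ from $x(0),y(0)$). Let $$P(w^0;1)=f(\bar x(1))+\sum_i\|x_i(1)-\bar x(1)\|^2+\frac{1-(1+\gamma)\eta^2}{32(1+1/\xi)\hat L(1)^2}\sum_i\|y_i(1)-\bar y(1)\|^2$$ be the potential at the start of stage $1$. Suppose that the positive integer $T^*$ satisfies $$T^*=\left\lceil\frac1\varepsilon\cdot\frac{128\,(P(w^0;1)-\underline f)}{\frac1{T^*}\sum_{t=1}^{T^*}(v^t-v^{t-1})^2}\right\rceil .$$ Then there is a stage $t\in\{1,\dots,T^*\}$ in which all $x_i^r(t)$, $0\le r\le R(t)$, and all $\tilde x_i^r(t)$, $1\le r\le R(t)$, $1\le i\le N$, lie in $X(t)$ at positive distance from the boundary of $X(t)$. Moreover, in that stage the constrained updates coincide with the unconstrained ones: for all $i$ and $0\le r<R(t)$,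 $\tilde x_i^{r+1}(t)$ minimizes $\langle y_i^r,u-x_i^r\rangle+\frac1{2\alpha(t)}\|u-x_i^r\|^2$ over all $u\in\mathbb R^K$, i.e. $\tilde x_i^{r+1}(t)=x_i^r(t)-\alpha(t)\,y_i^r(t)$. -/

import Mathlib

open scoped Gradient

namespace Magenta

/-- The space `ℝ^K` with the Euclidean norm. -/
abbrev Vec (K : ℕ) : Type := EuclideanSpace ℝ (Fin K)

/-- The average `(1/N) ∑ i, x i` of the blocks of a stacked vector. -/
noncomputable def avg {N K : ℕ} (x : Fin N → Vec K) : Vec K :=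
  (1 / (N : ℝ)) • ∑ i, x i

/-- The average function `f(u) = (1/N) ∑ i, f_i(u)`. -/
noncomputable def avgFun {N K : ℕ} (f : Fin N → Vec K → ℝ) (u : Vec K) : ℝ :=
  (1 / (N : ℝ)) * ∑ i, f i u

/-- `‖x - 1 x̄‖²`, the squared Euclidean norm in `ℝ^{NK}` of the consensus error. -/
noncomputable def consensusError {N K : ℕ} (x : Fin N → Vec K) : ℝ :=
  ∑ i, ‖x i - avg x‖ ^ 2

/-- Assumptions on the problem: the local functions are continuously differentiable on `ℝ^K`, on
every compact set `S` the gradient of `f_i` is Lipschitz with constant `Lip i S ≥ 1`, these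
constants are monotone in the compact set, and the average function is bounded below by `fmin`. -/
structure ProblemAssumption {N K : ℕ} (f : Fin N → Vec K → ℝ)
    (Lip : Fin N → Set (Vec K) → ℝ) (fmin : ℝ) : Prop where
  contDiff : ∀ i, ContDiff ℝ 1 (f i)
  lipschitz : ∀ i, ∀ S : Set (Vec K), IsCompact S →
    ∀ a ∈ S, ∀ b ∈ S, ‖∇ (f i) a - ∇ (f i) b‖ ≤ Lip i S * ‖a - b‖
  mono : ∀ i, ∀ S₁ S₂ : Set (Vec K), IsCompact S₁ → IsCompact S₂ → S₁ ⊆ S₂ →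
    Lip i S₁ ≤ Lip i S₂
  one_le : ∀ i, ∀ S : Set (Vec K), IsCompact S → 1 ≤ Lip i S
  lower : ∀ u, fmin < avgFun f u

/-- The second largest modulus of an eigenvalue of `W`. (For a mixing matrix, `1` is a simple
eigenvalue and the largest one; for a single agent there is no other eigenvalue and the value
is `0`.) -/
noncomputable def secondEigenvalue {N : ℕ} (W : Matrix (Fin N) (Fin N) ℝ) : ℝ :=
  sSup {s : ℝ | ∃ μ : ℝ, μ ≠ 1 ∧ Module.End.HasEigenvalue (Matrix.toLin' W) μ ∧ s = |μ|}

/-- Assumptions on the mixing matrix `W` of the communication graph `G`. -/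
structure IsMixingMatrix {N : ℕ} (G : SimpleGraph (Fin N)) (W : Matrix (Fin N) (Fin N) ℝ) :
    Prop where
  symm : W.IsSymm
  /-- The null space of `I - W` is the span of the all-one vector. -/
  null : ∀ u : Fin N → ℝ, (1 - W).mulVec u = 0 ↔ ∃ c : ℝ, u = fun _ => c
  le_one : (1 - W).PosSemidef
  neg_one_le : (1 + W).PosSemidef
  pos_of_adj : ∀ i j, G.Adj i j → 0 < W i j
  zero_of_not_adj : ∀ i j, i ≠ j → ¬ G.Adj i j → W i j = 0
  diag_nonneg : ∀ i, 0 ≤ W i i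
  second_lt_one : secondEigenvalue W < 1
  /-- The spectral norm of `W - (1/N) 1 1ᵀ` is less than one. -/
  norm_lt_one :
    ‖Matrix.toEuclideanCLM (𝕜 := ℝ)
      (W - Matrix.of fun _ _ => 1 / (N : ℝ) : Matrix (Fin N) (Fin N) ℝ)‖ < 1

/-- The feasible set `X(t)`: the closed ball of radius `v t` centred at `z`. -/
def feasible {K : ℕ} (v : ℕ → ℝ) (z : Vec K) (t : ℕ) : Set (Vec K) :=
  Metric.closedBall z (v t)

/-- `max_i L_i(S)`. -/
noncomputable def maxLip {N K : ℕ} (Lip : Fin N → Set (Vec K) → ℝ) (S : Set (Vec K)) : ℝ :=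
  ⨆ i, Lip i S

/-- The stepsize, as a function of `Lh = max_i L_i(X(t))`. -/
noncomputable def stepSize (N : ℕ) (γ ξ η Lh : ℝ) : ℝ :=
  min (min
    (1 / (8 * (N : ℝ)) * (1 / (Lh / (2 * (N : ℝ)) + (1 / γ + 5 / 4))))
    ((N : ℝ) * (1 - (1 + γ) * η ^ 2) * (1 - (1 + ξ) * η ^ 2) /
      (64 * (1 + 1 / ξ) * Lh ^ 2)))
    1

/-- The potential function
`f(x̄) + ‖x - 1 x̄‖² + (1 - (1+γ)η²) / (32 (1 + 1/ξ) Lh²) ‖y - 1 ȳ‖²`. -/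
noncomputable def potential {N K : ℕ} (f : Fin N → Vec K → ℝ) (γ ξ η Lh : ℝ)
    (x y : Fin N → Vec K) : ℝ :=
  avgFun f (avg x) + consensusError x +
    (1 - (1 + γ) * η ^ 2) / (32 * (1 + 1 / ξ) * Lh ^ 2) * consensusError y

/-- The objective of the local subproblem: `u ↦ ⟨y, u - x⟩ + ‖u - x‖² / (2α)`. -/
noncomputable def localModel {K : ℕ} (α : ℝ) (y x u : Vec K) : ℝ :=
  inner ℝ y (u - x) + 1 / (2 * α) * ‖u - x‖ ^ 2

/-- `x`, `xt`, `y` (indexed by the stage, the inner iteration and the agent) are the iterates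
`x_i^r(t)`, `x̃_i^r(t)`, `y_i^r(t)` of the stages `0, …, T` of MAGENTA, started at `x0`, with
feasible sets `X t`, stepsizes `α t` and `β`, and `R t` inner iterations in stage `t`. -/
structure IsRun {N K : ℕ} (f : Fin N → Vec K → ℝ) (W : Matrix (Fin N) (Fin N) ℝ)
    (X : ℕ → Set (Vec K)) (α : ℕ → ℝ) (β : ℝ) (R : ℕ → ℕ) (x0 : Fin N → Vec K) (T : ℕ)
    (x xt y : ℕ → ℕ → Fin N → Vec K) : Prop where
  init_x : ∀ i, x 0 0 i = x0 i
  init_y : ∀ i, y 0 0 i = ∇ (f i) (x0 i)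
  /-- `x̃_i^{r+1}` minimizes the local model over `X(t)`. -/
  step_mem : ∀ t ≤ T, ∀ r < R t, ∀ i, xt t (r + 1) i ∈ X t
  step_min : ∀ t ≤ T, ∀ r < R t, ∀ i,
    IsMinOn (localModel (α t) (y t r i) (x t r i)) (X t) (xt t (r + 1) i)
  step_x : ∀ t ≤ T, ∀ r < R t, ∀ i,
    x t (r + 1) i = ∑ j, W i j • (x t r j + β • (xt t (r + 1) j - x t r j))
  step_y : ∀ t ≤ T, ∀ r < R t, ∀ i,
    y t (r + 1) i = ∑ j, W i j • y t r j + ∇ (f i) (x t (r + 1) i) - ∇ (f i) (x t r i)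
  /-- The next stage starts from the output of the current one. -/
  next_x : ∀ t < T, ∀ i, x (t + 1) 0 i = x t (R t) i
  next_y : ∀ t < T, ∀ i, y (t + 1) 0 i = y t (R t) i

/-- The point `u` of `S` does not touch the boundary of `S`: it has positive distance from it. -/
def AwayFromBoundary {K : ℕ} (S : Set (Vec K)) (u : Vec K) : Prop :=
  u ∈ S ∧ 0 < Metric.infDist u (frontier S)

end Magenta

/-! The argument balances a potential against the growth of the radii. In every inner iteration the
potential falls by at least `1/(4Nα)·D + δ/2·E`, where `D` is the sum of the squared local steps
`‖x̃_i - x_i‖²`, `E` is the consensus error of `x`, and `δ = 1 - (1+γ)η²` (`potential_step_le`).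
Three estimates enter: smoothness of `f` along the averaged half step, contraction of consensus
errors by `η²` under mixing, and the tracking identity that `ȳ` is the average gradient. The
stepsize is small enough for the gain in `D` to absorb every other multiple of `D`.

Between stages the ball grows, the Lipschitz constant does not decrease, and the weight of the
`y`-term does not increase, so the potential cannot rise (`potential_antitone`). Since `f` is
bounded below, the decreases of stages `1, …, T` add up to at most `P - fmin`, and the equation for
`T` bounds this by the sum of `ε/128·(v t - v (t-1))²`. Hence some stage decreases the potential by
at most its own share.

In such a stage nothing can travel far (`norm_sub_add_norm_lt_of_small_decrease`). Cauchy-Schwarz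
over at most about `1/(εα)` iterations bounds the drift of the average, while single terms of the
decrease bound the consensus error and the local step. Each is less than a third of `v t - v (t-1)`,
and the stage starts in the ball of radius `v (t-1)`, so all iterates remain in the open ball of
radius `v t`. A constrained minimizer in the interior is the unconstrained one
(`eq_of_isMinOn_localModel`). -/

namespace Magenta

variable {N K : ℕ}

/-! ### Averages and consensus errors -/

lemma natCast_smul_avg (hN : 0 < N) (x : Fin N → Vec K) : (N : ℝ) • avg x = ∑ i, x i := by
  have : (N : ℝ) ≠ 0 := by positivity
  simp [avg, smul_smul, this]

lemma avg_add (x y : Fin N → Vec K) : avg (fun i => x i + y i) = avg x + avg y := by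
  simp [avg, Finset.sum_add_distrib, smul_add]

lemma avg_sub (x y : Fin N → Vec K) : avg (fun i => x i - y i) = avg x - avg y := by
  simp [avg, Finset.sum_sub_distrib, smul_sub]

lemma avg_smul (c : ℝ) (x : Fin N → Vec K) : avg (fun i => c • x i) = c • avg x := by
  simp [avg, ← Finset.smul_sum, smul_comm c]

lemma avg_apply (x : Fin N → Vec K) (k : Fin K) : avg x k = 1 / (N : ℝ) * ∑ i, x i k := by
  simp [avg]

lemma inner_avg (x : Fin N → Vec K) (u : Vec K) :
    inner ℝ u (avg x) = 1 / (N : ℝ) * ∑ i, inner ℝ u (x i) := by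
  simp [avg, inner_smul_right, inner_sum]

lemma avg_mem (hN : 0 < N) {S : Set (Vec K)} (hS : Convex ℝ S) {x : Fin N → Vec K}
    (hx : ∀ i, x i ∈ S) : avg x ∈ S := by
  have h0 : (N : ℝ) ≠ 0 := by positivity
  rw [avg, Finset.smul_sum]
  exact hS.sum_mem (fun _ _ => by positivity) (by simp [h0]) fun i _ => hx i

lemma convexOn_norm_sq {E : Type*} [SeminormedAddCommGroup E] [NormedSpace ℝ E] :
    ConvexOn ℝ Set.univ fun u : E => ‖u‖ ^ 2 :=
  (convexOn_norm convex_univ).pow (fun _ _ => norm_nonneg _) 2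

lemma norm_avg_sq_le (hN : 0 < N) (x : Fin N → Vec K) :
    ‖avg x‖ ^ 2 ≤ 1 / (N : ℝ) * ∑ i, ‖x i‖ ^ 2 := by
  have h0 : (N : ℝ) ≠ 0 := by positivity
  rw [avg, Finset.smul_sum, Finset.mul_sum]
  exact convexOn_norm_sq.map_sum_le (w := fun _ => 1 / (N : ℝ)) (fun _ _ => by positivity)
    (by simp [h0]) fun i _ => Set.mem_univ _

lemma consensusError_nonneg (x : Fin N → Vec K) : 0 ≤ consensusError x :=
  Finset.sum_nonneg fun _ _ => by positivity

lemma norm_sub_avg_sq_le (x : Fin N → Vec K) (i : Fin N) :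
    ‖x i - avg x‖ ^ 2 ≤ consensusError x :=
  Finset.single_le_sum (f := fun i => ‖x i - avg x‖ ^ 2) (fun _ _ => by positivity)
    (Finset.mem_univ i)

/-- Pythagoras: removing the mean subtracts `N‖x̄‖²` from the sum of squares. -/
lemma consensusError_le (hN : 0 < N) (x : Fin N → Vec K) :
    consensusError x ≤ ∑ i, ‖x i‖ ^ 2 := by
  have h : ∑ i, inner ℝ (x i) (avg x) = (N : ℝ) * ‖avg x‖ ^ 2 := by
    rw [← sum_inner, ← natCast_smul_avg hN, real_inner_smul_left, real_inner_self_eq_norm_sq]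
  have : consensusError x = ∑ i, ‖x i‖ ^ 2 - (N : ℝ) * ‖avg x‖ ^ 2 := by
    simp only [consensusError, norm_sub_sq_real, Finset.sum_add_distrib, Finset.sum_sub_distrib,
      ← Finset.mul_sum, h]
    simp; ring
  rw [this]
  have : 0 ≤ (N : ℝ) * ‖avg x‖ ^ 2 := by positivity
  linarith

lemma norm_add_sq_le_of_pos {E : Type*} [SeminormedAddCommGroup E] {c : ℝ} (hc : 0 < c)
    (a b : E) : ‖a + b‖ ^ 2 ≤ (1 + c) * ‖a‖ ^ 2 + (1 + 1 / c) * ‖b‖ ^ 2 := by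
  have h1 : ‖a + b‖ ^ 2 ≤ (‖a‖ + ‖b‖) ^ 2 := by gcongr; exact norm_add_le a b
  have h2 : 0 ≤ 1 / c * (c * ‖a‖ - ‖b‖) ^ 2 := by positivity
  have h3 : 1 / c * (c * ‖a‖ - ‖b‖) ^ 2 = c * ‖a‖ ^ 2 - 2 * ‖a‖ * ‖b‖ + 1 / c * ‖b‖ ^ 2 := by
    field_simp; ring
  nlinarith

lemma sum_norm_add_sq_le {c : ℝ} (hc : 0 < c) (x y : Fin N → Vec K) :
    ∑ i, ‖x i + y i‖ ^ 2 ≤ (1 + c) * ∑ i, ‖x i‖ ^ 2 + (1 + 1 / c) * ∑ i, ‖y i‖ ^ 2 := by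
  rw [Finset.mul_sum, Finset.mul_sum, ← Finset.sum_add_distrib]
  exact Finset.sum_le_sum fun i _ => norm_add_sq_le_of_pos hc _ _

lemma consensusError_add_le (hN : 0 < N) {c : ℝ} (hc : 0 < c) (x y : Fin N → Vec K) :
    consensusError (fun i => x i + y i) ≤
      (1 + c) * consensusError x + (1 + 1 / c) * ∑ i, ‖y i‖ ^ 2 := by
  have h : consensusError (fun i => x i + y i) ≤
      (1 + c) * consensusError x + (1 + 1 / c) * consensusError y := by
    unfold consensusError
    rw [avg_add]
    simpa only [add_sub_add_comm] using
      sum_norm_add_sq_le hc (fun i => x i - avg x) (fun i => y i - avg y)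
  have := mul_le_mul_of_nonneg_left (consensusError_le hN y) (show 0 ≤ 1 + 1 / c by positivity)
  linarith

/-! ### Mixing -/

/-- The stacked vector `(W ⊗ I) x`. -/
noncomputable def mix (W : Matrix (Fin N) (Fin N) ℝ) (x : Fin N → Vec K) : Fin N → Vec K :=
  fun i => ∑ j, W i j • x j

lemma mix_apply (W : Matrix (Fin N) (Fin N) ℝ) (x : Fin N → Vec K) (i : Fin N) (k : Fin K) :
    mix W x i k = W.mulVec (fun j => x j k) i := by
  simp [mix, Matrix.mulVec, dotProduct]

lemma mix_add (W : Matrix (Fin N) (Fin N) ℝ) (x y : Fin N → Vec K) :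
    mix W (fun j => x j + y j) = fun i => mix W x i + mix W y i := by
  funext i
  simp [mix, smul_add, Finset.sum_add_distrib]

section
variable {G : SimpleGraph (Fin N)} {W : Matrix (Fin N) (Fin N) ℝ}

lemma IsMixingMatrix.row_sum (hW : IsMixingMatrix G W) (i : Fin N) : ∑ j, W i j = 1 := by
  have h := congrFun ((hW.null fun _ => 1).2 ⟨1, rfl⟩) i
  rw [Matrix.sub_mulVec, Matrix.one_mulVec] at h
  simp [Matrix.mulVec, dotProduct] at h
  linarith

lemma IsMixingMatrix.col_sum (hW : IsMixingMatrix G W) (j : Fin N) : ∑ i, W i j = 1 := by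
  rw [← hW.row_sum j]
  exact Finset.sum_congr rfl fun i _ => hW.symm.apply j i

lemma IsMixingMatrix.nonneg (hW : IsMixingMatrix G W) (i j : Fin N) : 0 ≤ W i j := by
  rcases eq_or_ne i j with rfl | h
  · exact hW.diag_nonneg i
  · by_cases hG : G.Adj i j
    · exact (hW.pos_of_adj i j hG).le
    · exact (hW.zero_of_not_adj i j h hG).ge

lemma IsMixingMatrix.mix_mem (hW : IsMixingMatrix G W) {S : Set (Vec K)}
    (hS : Convex ℝ S) {x : Fin N → Vec K} (hx : ∀ i, x i ∈ S) (i : Fin N) : mix W x i ∈ S :=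
  hS.sum_mem (fun j _ => hW.nonneg i j) (hW.row_sum i) fun j _ => hx j

lemma IsMixingMatrix.avg_mix (hW : IsMixingMatrix G W)
    (x : Fin N → Vec K) : avg (mix W x) = avg x := by
  simp only [avg, mix]
  rw [Finset.sum_comm]
  simp [← Finset.sum_smul, hW.col_sum]

lemma IsMixingMatrix.sum_norm_mix_sq_le (hW : IsMixingMatrix G W) (x : Fin N → Vec K) :
    ∑ i, ‖mix W x i‖ ^ 2 ≤ ∑ i, ‖x i‖ ^ 2 := by
  calc ∑ i, ‖mix W x i‖ ^ 2 ≤ ∑ i, ∑ j, W i j * ‖x j‖ ^ 2 :=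
        Finset.sum_le_sum fun i _ => convexOn_norm_sq.map_sum_le
          (fun j _ => hW.nonneg i j) (hW.row_sum i) fun j _ => Set.mem_univ _
    _ = ∑ i, ‖x i‖ ^ 2 := by
        rw [Finset.sum_comm]
        simp [← Finset.sum_mul, hW.col_sum]

lemma abs_le_secondEigenvalue {μ : ℝ} (h1 : μ ≠ 1)
    (h : Module.End.HasEigenvalue (Matrix.toLin' W) μ) : |μ| ≤ secondEigenvalue W := by
  refine le_csSup ?_ ⟨μ, h1, h, rfl⟩
  refine (((Module.End.finite_hasEigenvalue (Matrix.toLin' W)).image fun μ => |μ|).subset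
    ?_).bddAbove
  rintro _ ⟨μ, -, h, rfl⟩
  exact ⟨μ, h, rfl⟩

lemma secondEigenvalue_nonneg : 0 ≤ secondEigenvalue W := by
  -- This covers an empty set of eigenvalues as well, where `sSup` is `0`.
  apply Real.sSup_nonneg
  rintro _ ⟨μ, -, -, rfl⟩
  exact abs_nonneg μ

/-- `W` contracts vectors orthogonal to the constants by its second largest eigenvalue modulus. -/
lemma IsMixingMatrix.sum_mulVec_sq_le (hW : IsMixingMatrix G W)
    (u : Fin N → ℝ) (hu : ∑ i, u i = 0) :
    ∑ i, W.mulVec u i ^ 2 ≤ secondEigenvalue W ^ 2 * ∑ i, u i ^ 2 := by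
  have hH : W.IsHermitian := by
    rw [Matrix.IsHermitian, Matrix.conjTranspose_eq_transpose_of_trivial]; exact hW.symm
  set b := hH.eigenvectorBasis
  have key : ∀ k, inner ℝ (b k) (WithLp.toLp 2 (W.mulVec u)) =
      hH.eigenvalues k * inner ℝ (b k) (WithLp.toLp 2 u) := by
    intro k
    have h1 : W.vecMul (b k).ofLp = hH.eigenvalues k • (b k).ofLp := by
      rw [← hH.mulVec_eigenvectorBasis k, ← Matrix.vecMul_transpose, hW.symm.eq]
    simp only [EuclideanSpace.inner_eq_star_dotProduct, star_trivial]
    rw [dotProduct_comm, Matrix.dotProduct_mulVec, h1, smul_dotProduct, dotProduct_comm,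
      smul_eq_mul]
  have hsq : ∀ w : Fin N → ℝ, ∑ i, w i ^ 2 = ∑ k, inner ℝ (b k) (WithLp.toLp 2 w) ^ 2 := by
    intro w
    have := b.sum_sq_norm_inner_right (WithLp.toLp 2 w)
    simpa [EuclideanSpace.norm_sq_eq] using this.symm
  rw [hsq (W.mulVec u), hsq u, Finset.mul_sum]
  refine Finset.sum_le_sum fun k _ => ?_
  rw [key, mul_pow]
  -- An eigenvector for the eigenvalue `1` is constant, hence orthogonal to `u`; every other
  -- eigenvalue has modulus at most `secondEigenvalue W`.
  by_cases h1 : hH.eigenvalues k = 1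
  · obtain ⟨c, hc⟩ := (hW.null (b k).ofLp).1 (by
      rw [Matrix.sub_mulVec, Matrix.one_mulVec, hH.mulVec_eigenvectorBasis k, h1, one_smul,
        sub_self])
    have : inner ℝ (b k) (WithLp.toLp 2 u) = 0 := by
      simp [EuclideanSpace.inner_eq_star_dotProduct, hc, dotProduct, ← Finset.sum_mul, hu]
    simp [this]
  · have hne : (b k).ofLp ≠ 0 := fun h => b.toBasis.ne_zero k (by
      simpa using congrArg (WithLp.toLp 2) h)
    have hev : Module.End.HasEigenvalue (Matrix.toLin' W) (hH.eigenvalues k) :=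
      Module.End.hasEigenvalue_of_hasEigenvector (x := (b k).ofLp) ⟨by
        rw [Module.End.mem_eigenspace_iff, Matrix.toLin'_apply,
          hH.mulVec_eigenvectorBasis k], hne⟩
    have := abs_le_secondEigenvalue h1 hev
    rw [← sq_abs (hH.eigenvalues k)]
    gcongr

/-- Each coordinate of `x - 1 x̄` sums to zero over the agents, so the scalar contraction applies
coordinate by coordinate; `W` fixes constants, so mixing commutes with subtracting the mean. -/
lemma IsMixingMatrix.consensusError_mix_le (hW : IsMixingMatrix G W)
    (hN : 0 < N) (x : Fin N → Vec K) :
    consensusError (mix W x) ≤ secondEigenvalue W ^ 2 * consensusError x := by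
  unfold consensusError
  rw [hW.avg_mix]
  simp only [EuclideanSpace.norm_sq_eq, Real.norm_eq_abs, sq_abs, PiLp.sub_apply]
  rw [Finset.sum_comm, Finset.sum_comm (s := (Finset.univ : Finset (Fin N)))
    (f := fun i k => (x i k - avg x k) ^ 2),
    Finset.mul_sum]
  refine Finset.sum_le_sum fun k _ => ?_
  have h0 : (N : ℝ) ≠ 0 := by positivity
  have := hW.sum_mulVec_sq_le (fun i => x i k - avg x k) (by
    simp [Finset.sum_sub_distrib, avg_apply, h0])
  refine le_of_eq_of_le (Finset.sum_congr rfl fun i _ => ?_) this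
  congr 1
  rw [mix_apply]
  simp [Matrix.mulVec, dotProduct, mul_sub, Finset.sum_sub_distrib, ← Finset.sum_mul, hW.row_sum]

lemma IsMixingMatrix.sum_norm_mix_sub_sq_le (hW : IsMixingMatrix G W)
    (hN : 0 < N) (x : Fin N → Vec K) :
    ∑ i, ‖mix W x i - x i‖ ^ 2 ≤ 4 * consensusError x := by
  have h1 := sum_norm_add_sq_le one_pos (fun i => mix W x i - avg x) (fun i => avg x - x i)
  simp only [sub_add_sub_cancel] at h1
  have h2 : ∑ i, ‖mix W x i - avg x‖ ^ 2 = consensusError (mix W x) := by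
    rw [consensusError, hW.avg_mix]
  have h3 : ∑ i, ‖avg x - x i‖ ^ 2 = consensusError x := by
    simp only [consensusError, norm_sub_rev]
  have h4 := hW.consensusError_mix_le hN x
  have h5 : secondEigenvalue W ^ 2 * consensusError x ≤ 1 * consensusError x := by
    gcongr
    · exact consensusError_nonneg x
    · exact pow_le_one₀ secondEigenvalue_nonneg hW.second_lt_one.le
  rw [h2, h3] at h1
  linarith

end

/-! ### The local subproblem -/

/-- Compare the minimizer with the midpoint of `x` and `u`, which is feasible by convexity. The
variational inequality would give `1/α` in place of `3/(4α)`, but the weaker constant suffices. -/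
lemma inner_le_of_isMinOn_localModel {α : ℝ} (hα : 0 < α) {S : Set (Vec K)} (hS : Convex ℝ S)
    {y x u : Vec K} (hx : x ∈ S) (hu : u ∈ S) (h : IsMinOn (localModel α y x) S u) :
    inner ℝ y (u - x) ≤ -(3 / (4 * α)) * ‖u - x‖ ^ 2 := by
  have hm : x + (1 / 2 : ℝ) • (u - x) ∈ S :=
    hS.add_smul_sub_mem hx hu ⟨by norm_num, by norm_num⟩
  have h1 := isMinOn_iff.1 h _ hm
  simp only [localModel, add_sub_cancel_left, inner_smul_right, norm_smul, mul_pow] at h1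
  norm_num at h1
  have e1 : -(3 / (4 * α)) * ‖u - x‖ ^ 2 = -(3 / 4 * (α⁻¹ * ‖u - x‖ ^ 2)) := by field_simp
  have e2 : α⁻¹ * (1 / 2) * ‖u - x‖ ^ 2 = 1 / 2 * (α⁻¹ * ‖u - x‖ ^ 2) := by ring
  have e3 : α⁻¹ * (1 / 2) * (1 / 4 * ‖u - x‖ ^ 2) = 1 / 8 * (α⁻¹ * ‖u - x‖ ^ 2) := by ring
  rw [e1]
  linarith

lemma localModel_eq {α : ℝ} (hα : 0 < α) (y x u : Vec K) :
    localModel α y x u =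
      1 / (2 * α) * ‖u - (x - α • y)‖ ^ 2 - α / 2 * ‖y‖ ^ 2 := by
  have : u - (x - α • y) = (u - x) + α • y := by abel
  rw [this, norm_add_sq_real, inner_smul_right, norm_smul, mul_pow, Real.norm_eq_abs, sq_abs,
    localModel, real_inner_comm]
  field_simp
  ring

/-- A minimizer of the local model over a set that lies in the interior of this set is the
unconstrained minimizer. -/
lemma eq_of_isMinOn_localModel {α : ℝ} (hα : 0 < α) {S : Set (Vec K)} {y x u : Vec K}
    (hu : u ∈ interior S) (h : IsMinOn (localModel α y x) S u) : u = x - α • y := by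
  set p := x - α • y
  have hcont : Continuous fun s : ℝ => u + s • (p - u) := by fun_prop
  have hS : ∀ᶠ s in nhds (0 : ℝ), u + s • (p - u) ∈ S :=
    hcont.continuousAt.eventually_mem (by simpa using mem_interior_iff_mem_nhds.1 hu)
  have h1 : ∀ᶠ s in nhds (0 : ℝ), s < 1 := eventually_lt_nhds one_pos
  obtain ⟨s, ⟨hsS, hs1⟩, hs0⟩ := ((hS.and h1).filter_mono nhdsWithin_le_nhds |>.and
    (self_mem_nhdsWithin : Set.Ioi (0 : ℝ) ∈ nhdsWithin 0 (Set.Ioi 0))).exists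
  have hs0 : 0 < s := hs0
  have h2 := isMinOn_iff.1 h _ hsS
  rw [localModel_eq hα, localModel_eq hα] at h2
  -- Up to a constant the model is the squared distance to `p`. Moving from `u` towards `p` by the
  -- fraction `s` stays in `S` and scales that distance by `(1 - s)²`, so minimality forces it to
  -- vanish.
  have e : u + s • (p - u) - p = (1 - s) • (u - p) := by module
  rw [e, norm_smul, mul_pow, Real.norm_eq_abs, sq_abs] at h2
  have h3 : ‖u - p‖ ^ 2 ≤ (1 - s) ^ 2 * ‖u - p‖ ^ 2 := by
    have : 0 < 1 / (2 * α) := by positivity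
    exact le_of_mul_le_mul_left (by linarith) this
  have h4 : ‖u - p‖ ^ 2 = 0 := by
    by_contra hne
    have : 0 < ‖u - p‖ ^ 2 := lt_of_le_of_ne (by positivity) (Ne.symm hne)
    have : (1 - s) ^ 2 < 1 := by nlinarith
    nlinarith
  exact sub_eq_zero.1 (by simpa using h4)

lemma isMinOn_univ_localModel {α : ℝ} (hα : 0 < α) (y x : Vec K) :
    IsMinOn (localModel α y x) Set.univ (x - α • y) := by
  refine isMinOn_iff.2 fun u _ => ?_
  rw [localModel_eq hα, localModel_eq hα]
  simp
  positivity

/-! ### Descent -/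

/-- Mean value inequality on the segment for the deviation of the derivative from its value at `a`.
It yields `L` rather than the sharp `L/2`, which the stepsize tolerates. -/
lemma le_of_gradient_lipschitz {f : Vec K → ℝ} (hf : ContDiff ℝ 1 f) {S : Set (Vec K)}
    (hS : Convex ℝ S) {L : ℝ} (hL : 0 ≤ L)
    (hlip : ∀ a ∈ S, ∀ b ∈ S, ‖∇ f a - ∇ f b‖ ≤ L * ‖a - b‖) {a b : Vec K}
    (ha : a ∈ S) (hb : b ∈ S) :
    f b - f a ≤ inner ℝ (∇ f a) (b - a) + L * ‖b - a‖ ^ 2 := by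
  have hseg : segment ℝ a b ⊆ S := hS.segment_subset ha hb
  have h := (convex_segment a b).norm_image_sub_le_of_norm_fderiv_le' (f := f)
    (φ := fderiv ℝ f a) (C := L * ‖b - a‖) (𝕜 := ℝ)
    (fun c _ => (hf.differentiable one_ne_zero) c) (fun c hc => ?_)
    (left_mem_segment ℝ a b) (right_mem_segment ℝ a b)
  · rw [← inner_gradient_left, Real.norm_eq_abs] at h
    have := (abs_le.1 h).2
    nlinarith
  · have h1 : ‖fderiv ℝ f c - fderiv ℝ f a‖ = ‖∇ f c - ∇ f a‖ := by
      rw [gradient, gradient, ← map_sub, LinearIsometryEquiv.norm_map]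
    rw [h1]
    refine (hlip c (hseg hc) a ha).trans ?_
    gcongr
    exact norm_sub_le_of_mem_segment hc

lemma avgFun_le_of_gradient_lipschitz (hN : 0 < N) {f : Fin N → Vec K → ℝ}
    (hf : ∀ i, ContDiff ℝ 1 (f i)) {S : Set (Vec K)} (hS : Convex ℝ S) {L : ℝ} (hL : 0 ≤ L)
    (hlip : ∀ i, ∀ a ∈ S, ∀ b ∈ S, ‖∇ (f i) a - ∇ (f i) b‖ ≤ L * ‖a - b‖) {a b : Vec K}
    (ha : a ∈ S) (hb : b ∈ S) :
    avgFun f b ≤ avgFun f a + inner ℝ (avg fun i => ∇ (f i) a) (b - a) + L * ‖b - a‖ ^ 2 := by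
  have h0 : (N : ℝ) ≠ 0 := by positivity
  have h : avgFun f b - avgFun f a ≤
      1 / (N : ℝ) * ∑ i, (inner ℝ (∇ (f i) a) (b - a) + L * ‖b - a‖ ^ 2) := by
    rw [avgFun, avgFun, ← mul_sub, ← Finset.sum_sub_distrib]
    gcongr with i
    exact le_of_gradient_lipschitz (hf i) hS hL (hlip i) ha hb
  rw [Finset.sum_add_distrib, mul_add, ← sum_inner, ← real_inner_smul_left, ← avg] at h
  simp [h0] at h
  linarith

lemma inner_le_young {E : Type*} [SeminormedAddCommGroup E] [InnerProductSpace ℝ E] {a : ℝ}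
    (ha : 0 < a) (u w : E) : inner ℝ u w ≤ a * ‖u‖ ^ 2 + 1 / (4 * a) * ‖w‖ ^ 2 := by
  have h1 := real_inner_le_norm u w
  have h2 : 0 ≤ 1 / (4 * a) * (2 * a * ‖u‖ - ‖w‖) ^ 2 := by positivity
  have h3 : 1 / (4 * a) * (2 * a * ‖u‖ - ‖w‖) ^ 2 =
      a * ‖u‖ ^ 2 - ‖u‖ * ‖w‖ + 1 / (4 * a) * ‖w‖ ^ 2 := by field_simp; ring
  linarith

/-- Change of the average function along the averaged half step, where `y` tracks the average
gradient. -/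
lemma avgFun_half_step_le (hN : 0 < N) {f : Fin N → Vec K → ℝ}
    (hf : ∀ i, ContDiff ℝ 1 (f i)) {S : Set (Vec K)} (hS : Convex ℝ S) {L : ℝ} (hL : 0 ≤ L)
    (hlip : ∀ i, ∀ a ∈ S, ∀ b ∈ S, ‖∇ (f i) a - ∇ (f i) b‖ ≤ L * ‖a - b‖)
    {α : ℝ} {x xt y : Fin N → Vec K} (hx : ∀ i, x i ∈ S) (hxt : ∀ i, xt i ∈ S)
    (hd : ∀ i, inner ℝ (y i) (xt i - x i) ≤ -(3 / (4 * α)) * ‖xt i - x i‖ ^ 2)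
    (hy : avg y = avg fun i => ∇ (f i) (x i)) {a b : ℝ} (ha : 0 < a) (hb : 0 < b) :
    avgFun f (avg x + (1 / 2 : ℝ) • avg fun i => xt i - x i) ≤ avgFun f (avg x)
      + (-(3 / (8 * (N * α))) + 1 / (8 * b * N) + 1 / (8 * a * N) + L / (4 * N))
        * ∑ i, ‖xt i - x i‖ ^ 2
      + a * L ^ 2 / (2 * N) * consensusError x + b / (2 * N) * consensusError y := by
  have h0 : (0 : ℝ) < N := by positivity
  set d : Fin N → Vec K := fun i => xt i - x i with hd_def
  set D := ∑ i, ‖xt i - x i‖ ^ 2 with hD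
  have hxa : avg x ∈ S := avg_mem hN hS hx
  have hb' : avg x + (1 / 2 : ℝ) • avg d ∈ S := by
    rw [hd_def, avg_sub]
    exact hS.add_smul_sub_mem hxa (avg_mem hN hS hxt) ⟨by norm_num, by norm_num⟩
  have h1 := avgFun_le_of_gradient_lipschitz hN hf hS hL hlip hxa hb'
  rw [add_sub_cancel_left, inner_smul_right, norm_smul, mul_pow] at h1
  have hda : ‖avg d‖ ^ 2 ≤ 1 / N * D := norm_avg_sq_le hN d
  have hg : ‖avg (fun i => ∇ (f i) (avg x)) - avg y‖ ^ 2 ≤ L ^ 2 / N * consensusError x := by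
    rw [hy, ← avg_sub]
    refine (norm_avg_sq_le hN _).trans ?_
    rw [consensusError, show L ^ 2 / (N : ℝ) = 1 / N * L ^ 2 by ring, mul_assoc,
      Finset.mul_sum _ _ (L ^ 2)]
    gcongr with i
    rw [← mul_pow, norm_sub_rev (x i)]
    gcongr
    exact hlip i _ hxa _ (hx i)
  have h2 : inner ℝ (avg (fun i => ∇ (f i) (avg x)) - avg y) (avg d) ≤
      a * (L ^ 2 / N * consensusError x) + 1 / (4 * a) * (1 / N * D) :=
    (inner_le_young ha _ _).trans (by gcongr)
  -- Agent `i` has descent information only for its own `y i`; replacing `avg y` by `y i` costs a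
  -- Young term paid by the consensus error of `y`.
  have h3 : inner ℝ (avg y) (avg d) ≤
      1 / N * (b * consensusError y + 1 / (4 * b) * D - 3 / (4 * α) * D) := by
    rw [inner_avg]
    gcongr
    rw [consensusError, hD, Finset.mul_sum, Finset.mul_sum, Finset.mul_sum,
      ← Finset.sum_add_distrib, ← Finset.sum_sub_distrib]
    refine Finset.sum_le_sum fun i _ => ?_
    have e : inner ℝ (avg y) (d i) = inner ℝ (avg y - y i) (d i) + inner ℝ (y i) (d i) := by
      rw [← inner_add_left, sub_add_cancel]
    have e1 := inner_le_young hb (avg y - y i) (d i)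
    have e2 := hd i
    rw [norm_sub_rev] at e1
    rw [e]
    simp only [hd_def] at e1 ⊢
    linarith
  rw [inner_sub_left] at h2
  have h4 : L * (‖(1 / 2 : ℝ)‖ ^ 2 * ‖avg d‖ ^ 2) ≤ L * (1 / 4 * (1 / N * D)) := by
    gcongr
    norm_num
  have e : avgFun f (avg x)
      + (-(3 / (8 * (N * α))) + 1 / (8 * b * N) + 1 / (8 * a * N) + L / (4 * N)) * D
      + a * L ^ 2 / (2 * N) * consensusError x + b / (2 * N) * consensusError y =
    avgFun f (avg x) + 1 / 2 * (a * (L ^ 2 / N * consensusError x) + 1 / (4 * a) * (1 / N * D))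
      + 1 / 2 * (1 / N * (b * consensusError y + 1 / (4 * b) * D - 3 / (4 * α) * D))
      + L * (1 / 4 * (1 / N * D)) := by
    have e3 : 3 / (8 * (N * α)) = 1 / 2 * (1 / N) * (3 / (4 * α)) := by
      rw [div_mul_div_comm, div_mul_div_comm]; congr 1 <;> ring
    have e4 : ∀ c : ℝ, 1 / (8 * c * N) = 1 / 2 * (1 / N) * (1 / (4 * c)) := fun c => by
      rw [div_mul_div_comm, div_mul_div_comm]; congr 1 <;> ring
    rw [e3, e4, e4]
    ring
  rw [e]
  linarith

/-! ### The stepsize -/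

section
variable {γ ξ η L : ℝ}

lemma stepSize_pos (hN : 0 < N) (hγ : 0 < γ) (hξ : 0 < ξ) (hγη : (1 + γ) * η ^ 2 < 1)
    (hξη : (1 + ξ) * η ^ 2 < 1) (hL : 0 < L) : 0 < stepSize N γ ξ η L := by
  have h1 : 0 < 1 - (1 + γ) * η ^ 2 := by linarith
  have h2 : 0 < 1 - (1 + ξ) * η ^ 2 := by linarith
  unfold stepSize
  refine lt_min (lt_min ?_ ?_) one_pos <;> positivity

lemma stepSize_bound_left (hN : 0 < N) (hγ : 0 < γ) (hL : 0 < L)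
    (hα : 0 < stepSize N γ ξ η L) :
    8 * (L / (2 * N) + (1 / γ + 5 / 4)) ≤ 1 / (N * stepSize N γ ξ η L) := by
  have h : stepSize N γ ξ η L ≤ 1 / (8 * (N : ℝ)) * (1 / (L / (2 * (N : ℝ)) + (1 / γ + 5 / 4))) :=
    (min_le_left _ _).trans (min_le_left _ _)
  rw [div_mul_div_comm, one_mul, le_div_iff₀ (by positivity)] at h
  rw [le_div_iff₀ (by positivity)]
  linarith

lemma stepSize_bound_right (hN : 0 < N) (hξ : 0 < ξ) (hγη : (1 + γ) * η ^ 2 < 1)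
    (hξη : (1 + ξ) * η ^ 2 < 1) (hL : 0 < L) (hα : 0 < stepSize N γ ξ η L) :
    64 * (1 + 1 / ξ) * L ^ 2 / (N ^ 2 * (1 - (1 + γ) * η ^ 2) * (1 - (1 + ξ) * η ^ 2)) ≤
      1 / (N * stepSize N γ ξ η L) := by
  have h1 : 0 < 1 - (1 + γ) * η ^ 2 := by linarith
  have h2 : 0 < 1 - (1 + ξ) * η ^ 2 := by linarith
  have h : stepSize N γ ξ η L ≤ (N : ℝ) * (1 - (1 + γ) * η ^ 2) * (1 - (1 + ξ) * η ^ 2) /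
      (64 * (1 + 1 / ξ) * L ^ 2) :=
    (min_le_left _ _).trans (min_le_right _ _)
  rw [le_div_iff₀ (by positivity)] at h
  rw [div_le_div_iff₀ (by positivity) (by positivity)]
  have := mul_le_mul_of_nonneg_left h (show (0 : ℝ) ≤ N by positivity)
  linarith

end

/-! ### One inner iteration -/

/-- One inner iteration decreases the potential by a multiple of the squared step length and of
the consensus error. -/
lemma potential_step_le (hN : 0 < N) {f : Fin N → Vec K → ℝ} (hf : ∀ i, ContDiff ℝ 1 (f i))
    {S : Set (Vec K)} (hS : Convex ℝ S) {L : ℝ} (hL : 0 < L)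
    (hlip : ∀ i, ∀ a ∈ S, ∀ b ∈ S, ‖∇ (f i) a - ∇ (f i) b‖ ≤ L * ‖a - b‖)
    {G : SimpleGraph (Fin N)} {W : Matrix (Fin N) (Fin N) ℝ} (hW : IsMixingMatrix G W)
    {η γ ξ : ℝ} (hη : η = secondEigenvalue W) (hγ : 0 < γ) (hξ : 0 < ξ)
    (hγη : (1 + γ) * η ^ 2 < 1) (hξη : (1 + ξ) * η ^ 2 < 1)
    {α : ℝ} (hα : α = stepSize N γ ξ η L)
    {x xt y xn yn : Fin N → Vec K} (hx : ∀ i, x i ∈ S) (hxt : ∀ i, xt i ∈ S)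
    (hmin : ∀ i, IsMinOn (localModel α (y i) (x i)) S (xt i))
    (hy : avg y = avg fun i => ∇ (f i) (x i))
    (hxn : xn = mix W fun j => x j + (1 / 2 : ℝ) • (xt j - x j))
    (hyn : ∀ i, yn i = mix W y i + ∇ (f i) (xn i) - ∇ (f i) (x i)) :
    potential f γ ξ η L xn yn + (1 / (4 * (N * α)) * ∑ i, ‖xt i - x i‖ ^ 2
      + (1 - (1 + γ) * η ^ 2) / 2 * consensusError x) ≤ potential f γ ξ η L x y := by
  have h0 : (0 : ℝ) < N := by positivity
  have hα0 : 0 < α := hα ▸ stepSize_pos hN hγ hξ hγη hξη hL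
  have hA1 := stepSize_bound_left (ξ := ξ) (η := η) hN hγ hL (hα ▸ hα0)
  have hA2 := stepSize_bound_right hN hξ hγη hξη hL (hα ▸ hα0)
  rw [← hα] at hA1 hA2
  unfold potential
  have hδ1 : 1 - (1 + γ) * η ^ 2 ≤ 1 := by nlinarith [sq_nonneg η]
  have hδ'1 : 1 - (1 + ξ) * η ^ 2 ≤ 1 := by nlinarith [sq_nonneg η]
  have hEx : (1 + γ) * η ^ 2 = 1 - (1 - (1 + γ) * η ^ 2) := by ring
  have hFx : (1 + ξ) * η ^ 2 = 1 - (1 - (1 + ξ) * η ^ 2) := by ring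
  set D := ∑ i, ‖xt i - x i‖ ^ 2 with hD
  have hD0 : 0 ≤ D := Finset.sum_nonneg fun _ _ => by positivity
  have hE0 := consensusError_nonneg x
  have hF0 := consensusError_nonneg y
  set E := consensusError x
  set F := consensusError y
  have hDh : ∑ i, ‖(1 / 2 : ℝ) • (xt i - x i)‖ ^ 2 = 1 / 4 * D := by
    rw [hD, Finset.mul_sum]
    refine Finset.sum_congr rfl fun i _ => ?_
    rw [norm_smul, mul_pow]; norm_num
  have hx_step : consensusError xn ≤ (1 + γ) * η ^ 2 * E + 1 / (4 * γ) * D := by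
    rw [hxn]
    refine (hW.consensusError_mix_le hN _).trans ?_
    rw [← hη]
    have := consensusError_add_le hN hγ x fun j => (1 / 2 : ℝ) • (xt j - x j)
    rw [hDh] at this
    have h2 := mul_le_mul_of_nonneg_left this (sq_nonneg η)
    -- The left side equals `(1+γ)η²/γ`, and `(1+γ)η² < 1`.
    have h3 : η ^ 2 * (1 + 1 / γ) ≤ 1 / γ := by
      rw [le_div_iff₀ hγ]
      have : η ^ 2 * (1 + 1 / γ) * γ = (1 + γ) * η ^ 2 := by field_simp; ring
      linarith
    have h4 := mul_le_mul_of_nonneg_right h3 (show 0 ≤ 1 / 4 * D by positivity)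
    have h5 : 1 / (4 * γ) * D = 1 / γ * (1 / 4 * D) := by field_simp
    rw [h5]
    linarith
  -- The displacement splits into pure mixing, at most `4E`, and the mixed half step, at most `D/4`;
  -- squaring the sum doubles both.
  have hmove : ∑ i, ‖xn i - x i‖ ^ 2 ≤ 8 * E + 1 / 2 * D := by
    have h1 := sum_norm_add_sq_le one_pos (fun i => mix W x i - x i)
      (mix W fun j => (1 / 2 : ℝ) • (xt j - x j))
    have h2 := hW.sum_norm_mix_sub_sq_le hN x
    have h3 := hW.sum_norm_mix_sq_le fun j => (1 / 2 : ℝ) • (xt j - x j)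
    rw [hDh] at h3
    have h4 : ∀ i, xn i - x i =
        mix W x i - x i + mix W (fun j => (1 / 2 : ℝ) • (xt j - x j)) i := fun i => by
      rw [hxn, mix_add]; exact add_sub_right_comm _ _ _
    simp only [h4]
    linarith
  have hxnS : ∀ i, xn i ∈ S := by
    rw [hxn]
    exact hW.mix_mem hS fun j =>
      hS.add_smul_sub_mem (hx j) (hxt j) ⟨by norm_num, by norm_num⟩
  have hy_step : consensusError yn ≤
      (1 + ξ) * η ^ 2 * F + (1 + 1 / ξ) * L ^ 2 * (8 * E + 1 / 2 * D) := by
    have e : yn = fun i => mix W y i + (∇ (f i) (xn i) - ∇ (f i) (x i)) := by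
      funext i; rw [hyn, add_sub_assoc]
    rw [e]
    refine (consensusError_add_le hN hξ _ _).trans ?_
    have h1 := hW.consensusError_mix_le hN y
    rw [← hη] at h1
    have h2 : ∑ i, ‖∇ (f i) (xn i) - ∇ (f i) (x i)‖ ^ 2 ≤ L ^ 2 * (8 * E + 1 / 2 * D) := by
      refine le_trans ?_ (mul_le_mul_of_nonneg_left hmove (sq_nonneg L))
      rw [Finset.mul_sum]
      gcongr with i
      rw [← mul_pow]
      gcongr
      exact hlip i _ (hxnS i) _ (hx i)
    rw [mul_assoc, mul_assoc]
    gcongr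
  have hxavg : avg xn = avg x + (1 / 2 : ℝ) • avg fun i => xt i - x i := by
    rw [hxn, hW.avg_mix, avg_add, avg_smul]
  set δ := 1 - (1 + γ) * η ^ 2
  set δ' := 1 - (1 + ξ) * η ^ 2
  have hδ : 0 < δ := by simp only [δ]; linarith
  have hδ' : 0 < δ' := by simp only [δ']; linarith
  rw [hEx] at hx_step
  rw [hFx] at hy_step
  set q := 1 + 1 / ξ with hq
  have hq1 : 1 ≤ q := by rw [hq]; have : 0 < 1 / ξ := by positivity
                         linarith
  have hq0 : 0 < q := by linarith
  set c := δ / (32 * q * L ^ 2) with hc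
  have hc0 : 0 < c := by positivity
  have hcq : c * (q * L ^ 2) = δ / 32 := by rw [hc]; field_simp
  -- The Young parameter `a` makes the `E`-term equal to `δ/4`; `b` makes the `F`-term equal to
  -- `cδ'`, exactly what the contraction of `F`, weighted by `c`, gains.
  have hf_step := avgFun_half_step_le hN hf hS hL.le hlip hx hxt
    (fun i => inner_le_of_isMinOn_localModel hα0 hS (hx i) (hxt i) (hmin i)) hy
    (a := N * δ / (2 * L ^ 2)) (b := 2 * N * c * δ') (by positivity) (by positivity)
  rw [← hxavg] at hf_step
  set κ := 1 / (N * α) with hκ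
  set m := L ^ 2 / (N ^ 2 * δ * δ') with hm
  have hm0 : 0 ≤ m := by positivity
  have e1 : 3 / (8 * (N * α)) = 3 / 8 * κ := by rw [hκ]; field_simp
  have e1' : 1 / (4 * (N * α)) = 1 / 4 * κ := by rw [hκ]; field_simp
  have e2 : 1 / (8 * (2 * N * c * δ') * N) = 2 * q * m := by
    rw [hc, hm]; field_simp; ring
  have e3 : 1 / (8 * (N * δ / (2 * L ^ 2)) * N) = 1 / 4 * (δ' * m) := by
    rw [hm]; field_simp; ring
  have e4 : N * δ / (2 * L ^ 2) * L ^ 2 / (2 * N) = δ / 4 := by field_simp; ring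
  have e5 : 2 * N * c * δ' / (2 * N) = c * δ' := by field_simp
  have e6 : L / (4 * N) = 1 / 2 * (L / (2 * N)) := by field_simp; ring
  have e7 : 64 * q * L ^ 2 / (N ^ 2 * δ * δ') = 64 * (q * m) := by rw [hm]; ring
  have e8 : 1 / (4 * γ) = 1 / 4 * (1 / γ) := by field_simp
  rw [e1, e2, e3, e4, e5, e6] at hf_step
  rw [e7] at hA2
  rw [e8] at hx_step
  rw [e1']
  have hδm : δ' * m ≤ q * m := by gcongr; linarith
  have hγ' : 0 < 1 / γ := by positivity
  have hLN : 0 < L / (2 * N) := by positivity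
  -- This collects all coefficients of `D`, including the claimed decrease `κ/4`; the remaining
  -- `κ/8` dominates by the two stepsize bounds. For `E`, the gain `δ` loses `δ/4` to `f` and
  -- `8·δ/32 = δ/4` to `y`, leaving `δ/2`.
  have hcoef : -(3 / 8 * κ) + 2 * q * m + 1 / 4 * (δ' * m) + 1 / 2 * (L / (2 * N))
      + 1 / 4 * (1 / γ) + δ / 64 + 1 / 4 * κ ≤ 0 := by linarith
  have hfin := mul_nonpos_of_nonpos_of_nonneg hcoef hD0
  have hy' := mul_le_mul_of_nonneg_left hy_step hc0.le
  have e9 : c * ((1 - δ') * F + q * L ^ 2 * (8 * E + 1 / 2 * D)) =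
      c * F - c * δ' * F + (c * (q * L ^ 2)) * (8 * E + 1 / 2 * D) := by ring
  rw [e9, hcq] at hy'
  linarith

/-! ### Lipschitz constants and the potential -/

lemma le_maxLip (Lip : Fin N → Set (Vec K) → ℝ) (S : Set (Vec K)) (i : Fin N) :
    Lip i S ≤ maxLip Lip S :=
  le_ciSup (f := fun i => Lip i S) (Set.finite_range _).bddAbove i

section
variable {f : Fin N → Vec K → ℝ} {Lip : Fin N → Set (Vec K) → ℝ} {fmin : ℝ}

lemma ProblemAssumption.one_le_maxLip (hf : ProblemAssumption f Lip fmin) (hN : 0 < N)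
    {S : Set (Vec K)} (hS : IsCompact S) : 1 ≤ maxLip Lip S :=
  (hf.one_le ⟨0, hN⟩ S hS).trans (le_maxLip Lip S _)

lemma ProblemAssumption.maxLip_mono (hf : ProblemAssumption f Lip fmin) (hN : 0 < N)
    {S₁ S₂ : Set (Vec K)} (h₁ : IsCompact S₁) (h₂ : IsCompact S₂) (h : S₁ ⊆ S₂) :
    maxLip Lip S₁ ≤ maxLip Lip S₂ :=
  have : Nonempty (Fin N) := ⟨⟨0, hN⟩⟩
  ciSup_le fun i => (hf.mono i _ _ h₁ h₂ h).trans (le_maxLip Lip _ i)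

lemma ProblemAssumption.norm_gradient_sub_le (hf : ProblemAssumption f Lip fmin)
    {S : Set (Vec K)} (hS : IsCompact S) (i : Fin N) {a b : Vec K} (ha : a ∈ S) (hb : b ∈ S) :
    ‖∇ (f i) a - ∇ (f i) b‖ ≤ maxLip Lip S * ‖a - b‖ :=
  (hf.lipschitz i S hS a ha b hb).trans (by gcongr; exact le_maxLip Lip S i)

end

/-- The Lipschitz constant enters only through the denominator of the `y`-weight. This permits
chaining stages with different balls. -/
lemma potential_antitone (f : Fin N → Vec K → ℝ) {γ ξ η L₁ L₂ : ℝ} (hξ : 0 < ξ)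
    (hγη : (1 + γ) * η ^ 2 < 1) (hL : 0 < L₁) (h : L₁ ≤ L₂) (x y : Fin N → Vec K) :
    potential f γ ξ η L₂ x y ≤ potential f γ ξ η L₁ x y := by
  have h1 : 0 ≤ 1 - (1 + γ) * η ^ 2 := by linarith
  unfold potential
  gcongr
  exact consensusError_nonneg y

lemma avgFun_le_potential (f : Fin N → Vec K → ℝ) {γ ξ η L : ℝ} (hξ : 0 < ξ)
    (hγη : (1 + γ) * η ^ 2 < 1) (x y : Fin N → Vec K) :
    avgFun f (avg x) ≤ potential f γ ξ η L x y := by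
  have h1 : 0 ≤ 1 - (1 + γ) * η ^ 2 := by linarith
  have h2 := consensusError_nonneg x
  have h3 := consensusError_nonneg y
  have h4 : 0 ≤ (1 - (1 + γ) * η ^ 2) / (32 * (1 + 1 / ξ) * L ^ 2) * consensusError y := by
    positivity
  unfold potential
  linarith

/-! ### The run -/

section
variable {f : Fin N → Vec K → ℝ} {G : SimpleGraph (Fin N)} {W : Matrix (Fin N) (Fin N) ℝ}
  {X : ℕ → Set (Vec K)} {α : ℕ → ℝ} {R : ℕ → ℕ} {x0 : Fin N → Vec K} {T : ℕ}
  {x xt y : ℕ → ℕ → Fin N → Vec K}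

lemma IsRun.x_succ (hrun : IsRun f W X α (1 / 2) R x0 T x xt y) {t r : ℕ} (ht : t ≤ T)
    (hr : r < R t) :
    x t (r + 1) = mix W fun j => x t r j + (1 / 2 : ℝ) • (xt t (r + 1) j - x t r j) :=
  funext fun i => hrun.step_x t ht r hr i

lemma IsRun.avg_x_succ (hW : IsMixingMatrix G W) (hrun : IsRun f W X α (1 / 2) R x0 T x xt y)
    {t r : ℕ} (ht : t ≤ T) (hr : r < R t) :
    avg (x t (r + 1)) =
      avg (x t r) + (1 / 2 : ℝ) • avg fun i => xt t (r + 1) i - x t r i := by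
  rw [hrun.x_succ ht hr, hW.avg_mix, avg_add, avg_smul]

lemma IsRun.x_succ_mem (hW : IsMixingMatrix G W) (hrun : IsRun f W X α (1 / 2) R x0 T x xt y)
    {t r : ℕ} (ht : t ≤ T) (hr : r < R t) {S : Set (Vec K)} (hS : Convex ℝ S)
    (hx : ∀ i, x t r i ∈ S) (hxt : ∀ i, xt t (r + 1) i ∈ S) (i : Fin N) :
    x t (r + 1) i ∈ S := by
  rw [hrun.x_succ ht hr]
  exact hW.mix_mem hS
    (fun j => hS.add_smul_sub_mem (hx j) (hxt j) ⟨by norm_num, by norm_num⟩) i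

/-- The iterates stay feasible and the averaged trackers are the averaged gradients. -/
lemma IsRun.mem_and_avg_y (hW : IsMixingMatrix G W)
    (hrun : IsRun f W X α (1 / 2) R x0 T x xt y) (hX : ∀ t, Convex ℝ (X t)) (hmono : Monotone X)
    (hx0 : ∀ i, x0 i ∈ X 0) : ∀ t ≤ T, ∀ r ≤ R t,
    (∀ i, x t r i ∈ X t) ∧ avg (y t r) = avg fun i => ∇ (f i) (x t r i) := by
  have inner_loop : ∀ t ≤ T,
      ((∀ i, x t 0 i ∈ X t) ∧ avg (y t 0) = avg fun i => ∇ (f i) (x t 0 i)) → ∀ r ≤ R t,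
      (∀ i, x t r i ∈ X t) ∧ avg (y t r) = avg fun i => ∇ (f i) (x t r i) := by
    intro t ht h0 r
    induction r with
    | zero => exact fun _ => h0
    | succ r ih =>
      intro hr
      obtain ⟨h1, h2⟩ := ih (by omega)
      refine ⟨hrun.x_succ_mem hW ht hr (hX t) h1 (hrun.step_mem t ht r hr), ?_⟩
      -- Gradient tracking: mixing preserves the average, so the gradients at iteration `r` cancel
      -- and those at `r + 1` remain.
      have e : y t (r + 1) = fun i =>
          mix W (y t r) i + ∇ (f i) (x t (r + 1) i) - ∇ (f i) (x t r i) :=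
        funext fun i => hrun.step_y t ht r hr i
      rw [e, avg_sub, avg_add, hW.avg_mix, h2]
      abel
  intro t
  induction t with
  | zero =>
    intro ht
    refine inner_loop 0 ht ⟨fun i => by rw [hrun.init_x]; exact hx0 i, ?_⟩
    congr 1
    funext i
    rw [hrun.init_y, hrun.init_x]
  | succ t ih =>
    intro ht
    obtain ⟨h1, h2⟩ := ih (by omega) (R t) le_rfl
    have ex : x (t + 1) 0 = x t (R t) := funext (hrun.next_x t ht)
    have ey : y (t + 1) 0 = y t (R t) := funext (hrun.next_y t ht)
    refine inner_loop _ ht ⟨fun i => ?_, ?_⟩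
    · rw [ex]; exact hmono t.le_succ (h1 i)
    · rw [ex, ey, h2]

end

/-- If the decrease of the potential in a stage is small compared with the squared growth of the
radius, then the iterates of this stage stay in the open ball. -/
lemma norm_sub_add_norm_lt_of_small_decrease (hN : 0 < N) {R : ℕ} {x xt : ℕ → Fin N → Vec K}
    {z : Vec K} {v₀ v₁ α δ ε : ℝ} (hv : v₀ < v₁) (hα : 0 < α) (hδ1 : δ ≤ 1) (hε : 0 < ε)
    (hεδ : ε < 2 * δ) (hNα : N * α ≤ 1 / 10) (hR : (R : ℝ) ≤ 1 / (ε * α) + 1)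
    (hx0 : ∀ i, x 0 i ∈ Metric.closedBall z v₀)
    (havg : ∀ r < R,
      avg (x (r + 1)) = avg (x r) + (1 / 2 : ℝ) • avg fun i => xt (r + 1) i - x r i)
    (hdec : ∑ r ∈ Finset.range R, (1 / (4 * (N * α)) * ∑ i, ‖xt (r + 1) i - x r i‖ ^ 2
      + δ / 2 * consensusError (x r)) ≤ ε / 128 * (v₁ - v₀) ^ 2)
    {r : ℕ} (hr : r < R) (i : Fin N) : ‖x r i - z‖ + ‖xt (r + 1) i - x r i‖ < v₁ := by
  have h0 : (0 : ℝ) < N := by positivity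
  have hδ : 0 < δ := by linarith
  set D : ℕ → ℝ := fun s => ∑ i, ‖xt (s + 1) i - x s i‖ ^ 2 with hD
  have hD0 : ∀ s, 0 ≤ D s := fun s => Finset.sum_nonneg fun _ _ => by positivity
  have hE0 : ∀ s, 0 ≤ consensusError (x s) := fun s => consensusError_nonneg _
  set Δ := v₁ - v₀ with hΔ
  have hΔ0 : 0 < Δ := by linarith
  have hterm : ∀ s, 0 ≤ 1 / (4 * (N * α)) * D s + δ / 2 * consensusError (x s) := fun s => by
    have := hD0 s
    have := hE0 s
    positivity
  have hsingle : 1 / (4 * (N * α)) * D r + δ / 2 * consensusError (x r) ≤ ε / 128 * Δ ^ 2 :=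
    (Finset.single_le_sum (f := fun s => 1 / (4 * (N * α)) * D s
      + δ / 2 * consensusError (x s)) (fun s _ => hterm s) (Finset.mem_range.2 hr)).trans hdec
  have hsum : 1 / (4 * (N * α)) * ∑ s ∈ Finset.range r, D s ≤ ε / 128 * Δ ^ 2 := by
    refine le_trans ?_ hdec
    rw [Finset.mul_sum]
    refine (Finset.sum_le_sum fun s _ => ?_).trans (Finset.sum_le_sum_of_subset_of_nonneg
      (Finset.range_mono hr.le) fun s _ _ => hterm s)
    have := hE0 s
    have : 0 ≤ δ / 2 * consensusError (x s) := by positivity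
    simp only [hD]
    linarith
  have hpath : ∀ s, s ≤ R → ‖avg (x s) - avg (x 0)‖ ≤
      1 / 2 * ∑ k ∈ Finset.range s, ‖avg fun i => xt (k + 1) i - x k i‖ := by
    intro s
    induction s with
    | zero => simp
    | succ s ih =>
      intro hs
      rw [havg s hs, add_sub_right_comm, Finset.sum_range_succ, mul_add]
      refine (norm_add_le _ _).trans (add_le_add (ih (by omega)) ?_)
      rw [norm_smul]; norm_num
  -- Cauchy-Schwarz gives `r/(4N)·∑ D = rα·(1/(4Nα)·∑ D)`, and `rα ≤ 1/ε` cancels the `ε` of the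
  -- assumed decrease.
  have hq : ‖avg (x r) - avg (x 0)‖ ^ 2 ≤ Δ ^ 2 / 128 := by
    have h1 : ‖avg (x r) - avg (x 0)‖ ^ 2 ≤
        (1 / 2 * ∑ k ∈ Finset.range r, ‖avg fun i => xt (k + 1) i - x k i‖) ^ 2 := by
      gcongr; exact hpath r hr.le
    have h2 := sq_sum_le_card_mul_sum_sq (s := Finset.range r)
      (f := fun k => ‖avg fun i => xt (k + 1) i - x k i‖)
    have h3 : ∑ k ∈ Finset.range r, ‖avg fun i => xt (k + 1) i - x k i‖ ^ 2 ≤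
        1 / N * ∑ s ∈ Finset.range r, D s := by
      rw [Finset.mul_sum]
      exact Finset.sum_le_sum fun s _ => norm_avg_sq_le hN _
    rw [Finset.card_range] at h2
    have h4 := mul_le_mul_of_nonneg_left h3 (show (0 : ℝ) ≤ r by positivity)
    have h5 : (r : ℝ) * (ε * α) ≤ 1 := by
      -- The strict inequality `r < R` compensates the `+ 1` that comes from rounding up.
      have : (r : ℝ) + 1 ≤ R := by exact_mod_cast hr
      rw [← le_div_iff₀ (by positivity)]
      linarith
    have h6 : (r : ℝ) * (1 / N * ∑ s ∈ Finset.range r, D s) =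
        4 * (r * α) * (1 / (4 * (N * α)) * ∑ s ∈ Finset.range r, D s) := by field_simp
    have h7 := mul_le_mul_of_nonneg_left hsum (show (0 : ℝ) ≤ 4 * (r * α) by positivity)
    have h8 := mul_le_mul_of_nonneg_right h5 (show (0 : ℝ) ≤ Δ ^ 2 / 128 by positivity)
    linarith
  have ha : ‖x r i - avg (x r)‖ ^ 2 ≤ Δ ^ 2 / 32 := by
    have h1 := norm_sub_avg_sq_le (x r) i
    have h2 : 0 ≤ 1 / (4 * (N * α)) * D r := by have := hD0 r; positivity
    have h3 : δ / 2 * consensusError (x r) ≤ δ / 2 * (Δ ^ 2 / 32) := by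
      have := mul_le_mul_of_nonneg_right hεδ.le (show (0 : ℝ) ≤ Δ ^ 2 / 128 by positivity)
      linarith
    exact h1.trans (le_of_mul_le_mul_left h3 (by positivity))
  have hb : ‖xt (r + 1) i - x r i‖ ^ 2 ≤ Δ ^ 2 / 32 := by
    have h1 : ‖xt (r + 1) i - x r i‖ ^ 2 ≤ D r :=
      Finset.single_le_sum (f := fun i => ‖xt (r + 1) i - x r i‖ ^ 2)
        (fun _ _ => by positivity) (Finset.mem_univ i)
    have h2 : 0 ≤ δ / 2 * consensusError (x r) := by have := hE0 r; positivity
    have h3 : D r ≤ 4 * (N * α) * (ε / 128 * Δ ^ 2) := by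
      rw [← div_le_iff₀' (by positivity), div_eq_mul_one_div, mul_comm (D r)]
      linarith
    have h4 : 4 * (N * α) * (ε / 128 * Δ ^ 2) ≤ 4 * (1 / 10) * (2 / 128 * Δ ^ 2) := by
      gcongr
      linarith
    have : 0 < Δ ^ 2 := by positivity
    linarith
  -- This is `1/32 < 1/9`.
  have third : ∀ w : Vec K, ‖w‖ ^ 2 ≤ Δ ^ 2 / 32 → ‖w‖ < Δ / 3 := fun w hw => by
    refine lt_of_pow_lt_pow_left₀ 2 (by positivity) ?_
    have : 0 < Δ ^ 2 := by positivity
    rw [div_pow]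
    linarith
  have hstart : ‖avg (x 0) - z‖ ≤ v₀ := by
    simpa [dist_eq_norm] using avg_mem hN (convex_closedBall z v₀) hx0
  have hq' := third (avg (x r) - avg (x 0)) (by have : 0 < Δ ^ 2 := by positivity
                                                linarith)
  have ha' := third _ ha
  have hb' := third _ hb
  have htri : ‖x r i - z‖ ≤
      ‖x r i - avg (x r)‖ + ‖avg (x r) - avg (x 0)‖ + ‖avg (x 0) - z‖ := by
    have e : x r i - z = (x r i - avg (x r)) + (avg (x r) - avg (x 0)) + (avg (x 0) - z) := by
      abel
    rw [e]
    exact norm_add₃_le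
  linarith

/-- Positive dimension makes the sphere nonempty. In dimension zero the frontier is empty, and
`Metric.infDist` to the empty set is `0`, so the claim would fail. -/
lemma awayFromBoundary_closedBall (hK : 0 < K) {z u : Vec K} {v : ℝ} (hv : 0 < v)
    (hu : u ∈ Metric.ball z v) : AwayFromBoundary (Metric.closedBall z v) u := by
  have : Nonempty (Fin K) := ⟨⟨0, hK⟩⟩
  refine ⟨Metric.ball_subset_closedBall hu, ?_⟩
  rw [frontier_closedBall _ hv.ne', ← Metric.isClosed_sphere.notMem_iff_infDist_pos
    (NormedSpace.sphere_nonempty.2 hv.le)]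
  exact fun h => (Metric.mem_ball.1 hu).ne (Metric.mem_sphere.1 h)

end Magenta

/-! ### The main theorem: telescoping over the stages and selection of a good one -/

open Magenta in
theorem theorem2 {N K : ℕ} (hN : 0 < N) (hK : 0 < K)
    (f : Fin N → Magenta.Vec K → ℝ) (Lip : Fin N → Set (Magenta.Vec K) → ℝ) (fmin : ℝ)
    (hf : Magenta.ProblemAssumption f Lip fmin)
    (G : SimpleGraph (Fin N)) (W : Matrix (Fin N) (Fin N) ℝ)
    (hW : Magenta.IsMixingMatrix G W)
    (η : ℝ) (hη : η = Magenta.secondEigenvalue W)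
    (γ ξ : ℝ) (hγ : 0 < γ) (hξ : 0 < ξ)
    (hγη : (1 + γ) * η ^ 2 < 1) (hξη : (1 + ξ) * η ^ 2 < 1)
    (ε : ℝ) (hε : 0 < ε) (hεη : ε < 2 * (1 - (1 + γ) * η ^ 2))
    -- the initial point, the radii and the feasible balls
    (x0 : Fin N → Magenta.Vec K) (v : ℕ → ℝ) (hv : StrictMono v)
    (X : ℕ → Set (Magenta.Vec K)) (hX : ∀ t, X t = Magenta.feasible v (Magenta.avg x0) t)
    (hx0 : ∀ i, x0 i ∈ X 0)
    -- the stepsizes and the numbers of inner iterations (that of stage `0` is arbitrary)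
    (α : ℕ → ℝ)
    (hα : ∀ t, α t = Magenta.stepSize N γ ξ η (Magenta.maxLip Lip (X t)))
    (R : ℕ → ℕ) (hR : ∀ t, 1 ≤ t → R t = ⌈1 / (ε * α t)⌉₊)
    -- the iterates of the stages `0, …, T`
    (T : ℕ) (hT : 0 < T) (x xt y : ℕ → ℕ → Fin N → Magenta.Vec K)
    (hrun : Magenta.IsRun f W X α (1 / 2) R x0 T x xt y)
    (hTstar : (T : ℤ) = ⌈1 / ε *
      (128 * (Magenta.potential f γ ξ η (Magenta.maxLip Lip (X 1)) (x 1 0) (y 1 0) - fmin) /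
        (1 / (T : ℝ) * ∑ t ∈ Finset.Icc 1 T, (v t - v (t - 1)) ^ 2))⌉) :
    ∃ t, 1 ≤ t ∧ t ≤ T ∧
      (∀ r ≤ R t, ∀ i, Magenta.AwayFromBoundary (X t) (x t r i)) ∧
      (∀ r, 1 ≤ r → r ≤ R t → ∀ i, Magenta.AwayFromBoundary (X t) (xt t r i)) ∧
      (∀ r < R t, ∀ i,
        IsMinOn (Magenta.localModel (α t) (y t r i) (x t r i)) Set.univ (xt t (r + 1) i) ∧
        xt t (r + 1) i = x t r i - α t • y t r i) := by
  have h0 : (0 : ℝ) < N := by positivity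
  have hXb : ∀ t, X t = Metric.closedBall (avg x0) (v t) := hX
  have hXc : ∀ t, IsCompact (X t) := fun t => by rw [hXb]; exact isCompact_closedBall _ _
  have hXconv : ∀ t, Convex ℝ (X t) := fun t => by rw [hXb]; exact convex_closedBall _ _
  have hXmono : Monotone X := fun s t hst => by
    rw [hXb, hXb]; exact Metric.closedBall_subset_closedBall (hv.monotone hst)
  -- Positivity of the radii is not assumed; it follows because the smallest ball contains the
  -- initial points.
  have hv0 : 0 ≤ v 0 := by
    have h := hx0 ⟨0, hN⟩
    rw [hXb] at h
    exact Metric.nonempty_closedBall.1 ⟨_, h⟩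
  have hvpos : ∀ t, 1 ≤ t → 0 < v t := fun t ht => hv0.trans_lt (hv (by omega))
  have hL1 : ∀ t, 1 ≤ maxLip Lip (X t) := fun t => hf.one_le_maxLip hN (hXc t)
  have hL0 : ∀ t, 0 < maxLip Lip (X t) := fun t => one_pos.trans_le (hL1 t)
  have hαpos : ∀ t, 0 < α t := fun t => by
    rw [hα]; exact stepSize_pos hN hγ hξ hγη hξη (hL0 t)
  have hinv := hrun.mem_and_avg_y hW hXconv hXmono hx0
  set δ := 1 - (1 + γ) * η ^ 2 with hδ_def
  have hδ0 : 0 < δ := by linarith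
  have hδ1 : δ ≤ 1 := by
    have : 0 ≤ (1 + γ) * η ^ 2 := by positivity
    linarith
  set pot : ℕ → ℕ → ℝ := fun t r =>
    potential f γ ξ η (maxLip Lip (X t)) (x t r) (y t r) with hpot
  set dec : ℕ → ℕ → ℝ := fun t r =>
    1 / (4 * (N * α t)) * ∑ i, ‖xt t (r + 1) i - x t r i‖ ^ 2
      + δ / 2 * consensusError (x t r) with hdec
  have hstep : ∀ t ≤ T, ∀ r < R t, pot t (r + 1) + dec t r ≤ pot t r := fun t ht r hr =>
    potential_step_le hN hf.contDiff (hXconv t) (hL0 t)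
      (fun i a ha b hb => hf.norm_gradient_sub_le (hXc t) i ha hb) hW hη hγ hξ hγη hξη (hα t)
      (hinv t ht r hr.le).1 (hrun.step_mem t ht r hr) (hrun.step_min t ht r hr)
      (hinv t ht r hr.le).2 (hrun.x_succ ht hr) (hrun.step_y t ht r hr)
  have hstage : ∀ t ≤ T, ∀ r ≤ R t,
      pot t r + ∑ s ∈ Finset.range r, dec t s ≤ pot t 0 := by
    intro t ht r
    induction r with
    | zero => simp
    | succ r ih =>
      intro hr
      have h1 := ih (by omega)
      have h2 := hstep t ht r hr
      rw [Finset.sum_range_succ]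
      linarith
  have htotal : ∀ n, n + 1 ≤ T → pot (n + 1) (R (n + 1))
      + ∑ t ∈ Finset.Icc 1 (n + 1), ∑ s ∈ Finset.range (R t), dec t s ≤ pot 1 0 := by
    intro n
    induction n with
    | zero =>
      intro h
      simpa using hstage 1 h (R 1) le_rfl
    | succ n ih =>
      intro h
      rw [Finset.sum_Icc_succ_top (by omega)]
      have h1 := ih (by omega)
      have h2 := hstage (n + 1 + 1) h _ le_rfl
      have h3 : pot (n + 1 + 1) 0 ≤ pot (n + 1) (R (n + 1)) := by
        have ex : x (n + 1 + 1) 0 = x (n + 1) (R (n + 1)) := funext (hrun.next_x (n + 1) h)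
        have ey : y (n + 1 + 1) 0 = y (n + 1) (R (n + 1)) := funext (hrun.next_y (n + 1) h)
        simp only [hpot, ex, ey]
        exact potential_antitone f hξ hγη (hL0 _)
          (hf.maxLip_mono hN (hXc _) (hXc _) (hXmono (Nat.le_succ _))) _ _
      linarith
  have hgap : ∑ t ∈ Finset.Icc 1 T, ∑ s ∈ Finset.range (R t), dec t s ≤ pot 1 0 - fmin := by
    obtain ⟨n, rfl⟩ : ∃ n, T = n + 1 := ⟨T - 1, by omega⟩
    have h1 := htotal n le_rfl
    have h2 := (hf.lower _).le.trans (avgFun_le_potential f (L := maxLip Lip (X (n + 1))) hξ hγη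
      (x (n + 1) (R (n + 1))) (y (n + 1) (R (n + 1))))
    linarith
  have hradii : pot 1 0 - fmin ≤ ∑ t ∈ Finset.Icc 1 T, ε / 128 * (v t - v (t - 1)) ^ 2 := by
    have hV : 0 < ∑ t ∈ Finset.Icc 1 T, (v t - v (t - 1)) ^ 2 := by
      refine Finset.sum_pos (fun t ht => ?_) ⟨1, Finset.mem_Icc.2 ⟨le_rfl, hT⟩⟩
      have : v (t - 1) < v t := hv (by have := (Finset.mem_Icc.1 ht).1; omega)
      have : 0 < v t - v (t - 1) := by linarith
      positivity
    have hT0 : (0 : ℝ) < T := by exact_mod_cast hT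
    -- Only `a ≤ ⌈a⌉` is needed. The factor `1/T` in the mean squared increment cancels against the
    -- `T` on the other side, which makes the implicit equation for `T` usable.
    have h1 := Int.le_ceil (1 / ε * (128 * (pot 1 0 - fmin) /
      (1 / (T : ℝ) * ∑ t ∈ Finset.Icc 1 T, (v t - v (t - 1)) ^ 2)))
    rw [← hTstar, Int.cast_natCast, ← mul_div_assoc, div_le_iff₀ (by positivity)] at h1
    rw [← Finset.mul_sum]
    set V := ∑ t ∈ Finset.Icc 1 T, (v t - v (t - 1)) ^ 2
    have e1 : (T : ℝ) * (1 / T * V) = V := by field_simp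
    rw [e1] at h1
    have h2 := mul_le_mul_of_nonneg_left h1 (show 0 ≤ ε / 128 by positivity)
    have e2 : ε / 128 * (1 / ε * (128 * (pot 1 0 - fmin))) = pot 1 0 - fmin := by field_simp
    linarith
  obtain ⟨t, ht, hsmall⟩ := Finset.exists_le_of_sum_le ⟨1, Finset.mem_Icc.2 ⟨le_rfl, hT⟩⟩
    (hgap.trans hradii)
  obtain ⟨ht1, htT⟩ := Finset.mem_Icc.1 ht
  -- The constant is `8 · 5/4 = 10`, from the first stepsize bound.
  have hNα : N * α t ≤ 1 / 10 := by
    have h1 := stepSize_bound_left (ξ := ξ) (η := η) hN hγ (hL0 t) (hα t ▸ hαpos t)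
    rw [← hα] at h1
    have h2 : 0 < maxLip Lip (X t) / (2 * N) := by have := hL0 t; positivity
    have h3 : 0 < 1 / γ := by positivity
    have h4 : 0 < N * α t := by have := hαpos t; positivity
    rw [le_div_iff₀ (by norm_num), mul_comm, ← le_div_iff₀ h4]
    linarith
  have hRt : (R t : ℝ) ≤ 1 / (ε * α t) + 1 := by
    rw [hR t ht1]
    have := hαpos t
    exact (Nat.ceil_lt_add_one (by positivity)).le
  have hstart : ∀ i, x t 0 i ∈ Metric.closedBall (avg x0) (v (t - 1)) := by
    intro i
    obtain ⟨s, rfl⟩ : ∃ s, t = s + 1 := ⟨t - 1, by omega⟩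
    rw [hrun.next_x s htT, Nat.add_sub_cancel, ← hXb]
    exact (hinv s (by omega) (R s) le_rfl).1 i
  have hin : ∀ r < R t, ∀ i,
      ‖x t r i - avg x0‖ + ‖xt t (r + 1) i - x t r i‖ < v t := fun r hr i =>
    norm_sub_add_norm_lt_of_small_decrease hN (hv (show t - 1 < t by omega)) (hαpos t) hδ1 hε hεη
      hNα hRt hstart (fun r hr => hrun.avg_x_succ hW htT hr) hsmall hr i
  have hx_in : ∀ r < R t, ∀ i, x t r i ∈ Metric.ball (avg x0) (v t) := fun r hr i => by
    rw [Metric.mem_ball, dist_eq_norm]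
    linarith [hin r hr i, norm_nonneg (xt t (r + 1) i - x t r i)]
  have hxt_in : ∀ r < R t, ∀ i, xt t (r + 1) i ∈ Metric.ball (avg x0) (v t) := fun r hr i => by
    rw [Metric.mem_ball, dist_eq_norm]
    have h1 := hin r hr i
    have h2 := norm_sub_le_norm_sub_add_norm_sub (xt t (r + 1) i) (x t r i) (avg x0)
    linarith
  have hRpos : 0 < R t := by
    rw [hR t ht1, Nat.ceil_pos]
    have := hαpos t
    positivity
  -- The decrease controls iterations `r < R t` only. The final iterate is a convex combination of
  -- points of the open ball; a previous iteration exists since `R t > 0`.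
  have hx_in' : ∀ r ≤ R t, ∀ i, x t r i ∈ Metric.ball (avg x0) (v t) := by
    intro r hr i
    rcases hr.lt_or_eq with hr | rfl
    · exact hx_in r hr i
    · obtain ⟨s, hs⟩ : ∃ s, R t = s + 1 := ⟨R t - 1, by omega⟩
      rw [hs]
      exact hrun.x_succ_mem hW htT (by omega) (convex_ball _ _) (hx_in s (by omega))
        (hxt_in s (by omega)) i
  refine ⟨t, ht1, htT, fun r hr i => ?_, fun r hr1 hr i => ?_, fun r hr i => ?_⟩
  · rw [hXb]
    exact awayFromBoundary_closedBall hK (hvpos t ht1) (hx_in' r hr i)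
  · obtain ⟨s, rfl⟩ : ∃ s, r = s + 1 := ⟨r - 1, by omega⟩
    rw [hXb]
    exact awayFromBoundary_closedBall hK (hvpos t ht1) (hxt_in s hr i)
  · have hint : xt t (r + 1) i ∈ interior (X t) := by
      rw [hXb]
      exact Metric.ball_subset_interior_closedBall (hxt_in r hr i)
    have heq := eq_of_isMinOn_localModel (hαpos t) hint (hrun.step_min t htT r hr i)
    exact ⟨heq ▸ isMinOn_univ_localModel (hαpos t) _ _, heq⟩
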